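/- Let $q$ be a prime power and $n\ge 0$. Let $V$ be a vector space of dimension $2n$ over the field $\mathbb F_q$ with $q$ elements (of even or odd characteristic), and let $Q$ be a nondegenerate quadratic form on $V$. The Witt index of $Q$ is the largest dimension of a subspace of $V$ on which $Q$ vanishes identically. If the Witt index is $n-1$ (so $n\ge 1$), the group of all invertible linear maps of $V$ preserving $Q$ is $O^-(2n,q)$; if it is $n$, this group is $O^+(2n,q)$. Let $Z_n^-$ and $Z_n^+$ be the numbers of vectors of $V$ fixed by a uniformly distributed random element of $O^-(2n,q)$ and of $O^+(2n,q)$, respectively. Then for all integers $j\ge 0$ and all $n\ge j+1$, $$E\big[(Z_n^-)^j\big]=\prod_{i=1}^{j}(q^i+1).$$ Moreover, these moments stabilize exactly one step later than those for $O^+$: for every $j\ge 1$ and $1\le n\le j$ one has $E[(Z_n^-)^j]\neq\prod_{i=1}^{j}(q^i+1)$, whereas for every $j\ge 0$ one has $E[(Z_n^+)^j]=\prod_{i=1}^{j}(q^i+1)$ for all $n\ge j$, and $E[(Z_n^+)^j]\ne\prod_{i=1}^{j}(q^i+1)$ for all $0\le n<j$. -/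

import Mathlib

open scoped BigOperators

/-- The orthogonal group of a quadratic form `Q` on `V`: the invertible linear maps preserving `Q`. -/
def orthogonalGroupOf {F V : Type*} [Field F] [AddCommGroup V] [Module F V]
    (Q : QuadraticForm F V) : Subgroup (V ≃ₗ[F] V) where
  carrier := {g | ∀ v, Q (g v) = Q v}
  mul_mem' := by
    intro a b ha hb v
    rw [LinearEquiv.mul_apply, ha, hb]
  one_mem' := fun _ => rfl
  inv_mem' := by
    intro a ha v
    have h := ha (a⁻¹ v)
    rw [← LinearEquiv.mul_apply, mul_inv_cancel, LinearEquiv.coe_one, id] at h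
    exact h.symm

/-- A subspace is totally singular if the quadratic form vanishes on it. -/
def IsTotallySingular {F V : Type*} [Field F] [AddCommGroup V] [Module F V]
    (Q : QuadraticForm F V) (W : Submodule F V) : Prop :=
  ∀ w ∈ W, Q w = 0

/-- The Witt index: the largest dimension of a totally singular subspace
(meant for finite-dimensional `V`, where these dimensions are bounded by that of `V`). -/
noncomputable def wittIndex {F V : Type*} [Field F] [AddCommGroup V] [Module F V]
    (Q : QuadraticForm F V) : ℕ :=
  sSup {d | ∃ W : Submodule F V, IsTotallySingular Q W ∧ Module.finrank F W = d}

/-- `Q` is a form of plus type on a space of dimension `2n`: nondegenerate of Witt index `n`.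
Over a field with `q` elements its orthogonal group is `O⁺(2n,q)`. -/
structure IsPlusType {F V : Type*} [Field F] [AddCommGroup V] [Module F V]
    (Q : QuadraticForm F V) (n : ℕ) : Prop where
  finrank_eq : Module.finrank F V = 2 * n
  nondegenerate : Q.Nondegenerate
  wittIndex_eq : wittIndex Q = n

/-- `Q` is a form of minus type on a space of dimension `2n`: nondegenerate of Witt index `n - 1`
(so `n ≥ 1`). Over a field with `q` elements its orthogonal group is `O⁻(2n,q)`. -/
structure IsMinusType {F V : Type*} [Field F] [AddCommGroup V] [Module F V]
    (Q : QuadraticForm F V) (n : ℕ) : Prop where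
  finrank_eq : Module.finrank F V = 2 * n
  nondegenerate : Q.Nondegenerate
  wittIndex_eq : wittIndex Q + 1 = n

/-- The number of fixed vectors of an element of the orthogonal group in its natural action. -/
noncomputable def numFixedVectors {F V : Type*} [Field F] [AddCommGroup V] [Module F V]
    {Q : QuadraticForm F V} (g : orthogonalGroupOf Q) : ℕ :=
  Nat.card {v : V // (g : V ≃ₗ[F] V) v = v}

instance finite_orthogonalGroupOf {F V : Type*} [Field F] [Finite F] [AddCommGroup V] [Module F V]
    [Module.Finite F V] (Q : QuadraticForm F V) : Finite (orthogonalGroupOf Q) := by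
  have : Finite V := Module.finite_of_finite F
  have : Finite (V ≃ₗ[F] V) := DFunLike.finite _
  infer_instance

/-- The expected value of the `j`-th power of the number of fixed vectors of a uniformly random
element of the orthogonal group of `Q` (`Finset.expect` is the average over the finite group). -/
noncomputable def fixedVectorMoment {F V : Type*} [Field F] [Finite F] [AddCommGroup V]
    [Module F V] [Module.Finite F V] (Q : QuadraticForm F V) (j : ℕ) : ℝ :=
  letI := Fintype.ofFinite (orthogonalGroupOf Q)
  Finset.expect Finset.univ fun g : orthogonalGroupOf Q => (numFixedVectors g : ℝ) ^ j

/-! By Burnside's lemma, the `j`-th moment of the number of fixed vectors is the number of orbits of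
the orthogonal group on `V ^ j`. A tuple is the same as a linear map `F ^ j → V`; attach to it its
kernel `W` and the pulled-back form, which descends to `F ^ j ⧸ W`. Witt's extension theorem
(`exists_isometry_comp_eq`) says that this pair determines the orbit, so the moment counts the pairs
that occur.

Let `q = |F|`. The number of all pairs is the sum over `W` of `q ^ (r (r + 1) / 2)` with `r = codim
W`, which is `∏ (q ^ i + 1)` by a form of the `q`-binomial theorem
(`Submodule.sum_card_quadraticForm`). Every pair occurs if `j` is at most the Witt index
(`exists_injective_comp_eq`). If `j` exceeds it, the zero form with `W = 0` does not occur, and the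
moment is strictly smaller. The Witt indices `n - 1` and `n` give the two thresholds. -/

/-! ### Nondegeneracy of the polar form -/

section Witt

variable {F V : Type*} [Field F] [AddCommGroup V] [Module F V]

open QuadraticMap Module

/-- For an alternating bilinear form, the dimensions of the space and of the radical have the
same parity. -/
theorem LinearMap.BilinForm.IsAlt.even_finrank_add_finrank_ker [FiniteDimensional F V]
    {B : LinearMap.BilinForm F V} (hB : B.IsAlt) :
    Even (finrank F V + finrank F (LinearMap.ker B)) := by
  -- A maximal totally isotropic `L` is its own orthogonal, so the dimension formula reads `2 dim L
  -- = dim V + dim ker B`.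
  obtain ⟨L, hL⟩ := exists_maximal_of_wellFoundedGT
    (fun L : Submodule F V => ∀ x ∈ L, ∀ y ∈ L, B x y = 0) ⟨⊥, by simp⟩
  have hLo : B.orthogonal L = L := by
    apply le_antisymm
    · intro x hx
      have hx' : ∀ y ∈ L, B y x = 0 := hx
      have hx'' : ∀ y ∈ L, B x y = 0 := fun y hy => hB.isRefl _ _ (hx' y hy)
      have := hL.2 (y := L ⊔ F ∙ x) (by
        intro a ha b hb
        obtain ⟨y, hy, z, hz, rfl⟩ := Submodule.mem_sup.1 ha
        obtain ⟨y', hy', z', hz', rfl⟩ := Submodule.mem_sup.1 hb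
        obtain ⟨c, rfl⟩ := Submodule.mem_span_singleton.1 hz
        obtain ⟨c', rfl⟩ := Submodule.mem_span_singleton.1 hz'
        simp [hL.1 y hy y' hy', hx' y hy, hx'' y' hy', hB.self_eq_zero]) le_sup_left
      exact this (Submodule.mem_sup_right (Submodule.mem_span_singleton_self x))
    · intro x hx y hy
      exact hL.1 y hy x hx
  have hker : B.orthogonal ⊤ = LinearMap.ker B := by
    ext x
    simp only [LinearMap.BilinForm.mem_orthogonal_iff, Submodule.mem_top, true_implies, LinearMap.mem_ker]
    exact ⟨fun h => LinearMap.ext fun y => hB.isRefl _ _ (h y),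
      fun h y => hB.isRefl _ _ (by simp [h])⟩
  have h := LinearMap.BilinForm.finrank_add_finrank_orthogonal hB.isRefl L
  rw [hLo, hker, inf_eq_right.2] at h
  · exact ⟨_, h.symm⟩
  · rw [← hLo, ← hker]
    exact LinearMap.BilinForm.orthogonal_le le_top

/-- On an even-dimensional space, a nondegenerate quadratic form has nondegenerate polar form,
in every characteristic. -/
theorem QuadraticMap.Nondegenerate.ker_polarBilin_eq_bot [FiniteDimensional F V]
    {Q : QuadraticForm F V} (hQ : Q.Nondegenerate) (hV : Even (finrank F V)) :
    LinearMap.ker Q.polarBilin = ⊥ := by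
  by_cases h2 : (2 : F) = 0
  -- In characteristic 2 nondegeneracy allows the polar form a radical of dimension at most 1;
  -- parity excludes dimension 1.
  · have halt : LinearMap.BilinForm.IsAlt (Q.polarBilin) := by
      intro x
      rw [polarBilin_apply_apply, polar_self, nsmul_eq_mul]
      simp [h2]
    have h1 := halt.even_finrank_add_finrank_ker
    have h3 : finrank F (LinearMap.ker Q.polarBilin) ≤ 1 := by
      have := hQ.rank_rad_polar_le
      rw [← finrank_eq_rank] at this
      exact_mod_cast this
    rw [Nat.even_add] at h1
    have h4 := h1.1 hV
    rw [← Submodule.finrank_eq_zero (R := F)]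
    interval_cases h : finrank F (LinearMap.ker Q.polarBilin)
    · rfl
    · simp at h4
  · let _ := invertibleOfNonzero h2
    rw [← radical_eq_ker_polarBilin, hQ.radical_eq_bot]

/-! ### Isometries and Witt's extension theorem -/

/-- An isometric endomorphism of a space with nondegenerate polar form is bijective. -/
theorem exists_mem_orthogonalGroupOf_of_isometry [FiniteDimensional F V] {Q : QuadraticForm F V}
    (hQ : LinearMap.ker Q.polarBilin = ⊥) (T : V →ₗ[F] V) (hT : ∀ x, Q (T x) = Q x) :
    ∃ g ∈ orthogonalGroupOf Q, ∀ x, g x = T x := by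
  have hpol : ∀ x y, polar Q (T x) (T y) = polar Q x y := by
    intro x y
    simp only [polar, ← map_add, hT]
  have hinj : Function.Injective T := by
    rw [← LinearMap.ker_eq_bot, LinearMap.ker_eq_bot']
    intro x hx
    have : x ∈ LinearMap.ker Q.polarBilin := by
      rw [LinearMap.mem_ker]
      ext y
      rw [polarBilin_apply_apply, ← hpol, hx]
      simp
    simpa [hQ] using this
  exact ⟨LinearEquiv.ofInjectiveEndo T hinj, hT, fun x => rfl⟩

theorem exists_polar_eq [FiniteDimensional F V] {Q : QuadraticForm F V}
    (hQ : LinearMap.ker Q.polarBilin = ⊥) (φ : Dual F V) : ∃ a, ∀ x, polar Q x a = φ x := by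
  have : Function.Surjective (Q.polarBilin : V →ₗ[F] Dual F V) :=
    (LinearMap.injective_iff_surjective_of_finrank_eq_finrank
      (Subspace.dual_finrank_eq (K := F) (V := V)).symm).1 (LinearMap.ker_eq_bot.1 hQ)
  obtain ⟨a, ha⟩ := this φ
  exact ⟨a, fun x => by rw [polar_comm, ← polarBilin_apply_apply, ha]⟩

theorem exists_polar_eq_one_of_notMem [FiniteDimensional F V] {Q : QuadraticForm F V}
    (hQ : LinearMap.ker Q.polarBilin = ⊥) {S : Submodule F V} {u : V} (hu : u ∉ S) :
    ∃ a, polar Q u a = 1 ∧ ∀ h ∈ S, polar Q h a = 0 := by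
  obtain ⟨φ, hφ, hS⟩ := Submodule.exists_le_ker_of_notMem hu
  obtain ⟨a, ha⟩ := exists_polar_eq hQ ((φ u)⁻¹ • φ)
  refine ⟨a, by simp [ha, hφ], fun h hh => ?_⟩
  have : φ h = 0 := hS hh
  simp [ha, this]

/-- The reflection along a nonsingular vector. -/
theorem exists_reflection [FiniteDimensional F V] {Q : QuadraticForm F V}
    (hQ : LinearMap.ker Q.polarBilin = ⊥) {w : V} (hw : Q w ≠ 0) :
    ∃ g ∈ orthogonalGroupOf Q, ∀ x, g x = x - (polar Q x w / Q w) • w := by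
  refine exists_mem_orthogonalGroupOf_of_isometry hQ
    (LinearMap.id - (LinearMap.toSpanSingleton F V w) ∘ₗ ((Q w)⁻¹ • Q.polarBilin.flip w)) ?_ |>.imp
      fun g hg => ⟨hg.1, fun x => ?_⟩
  · intro x
    simp only [sub_eq_add_neg, LinearMap.add_apply, LinearMap.neg_apply, LinearMap.id_apply,
      LinearMap.comp_apply, LinearMap.smul_apply, LinearMap.flip_apply, polarBilin_apply_apply,
      LinearMap.toSpanSingleton_apply, QuadraticMap.map_add Q, QuadraticMap.map_neg,
      QuadraticMap.map_smul, polar_neg_right, polar_smul_right, smul_eq_mul]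
    field_simp
    ring
  · rw [hg.2]
    simp [div_eq_inv_mul]

/-- The Eichler transformation attached to a singular vector `w` and a vector `a` orthogonal
to it. -/
theorem exists_eichler [FiniteDimensional F V] {Q : QuadraticForm F V}
    (hQ : LinearMap.ker Q.polarBilin = ⊥) {w a : V} (hw : Q w = 0) (ha : polar Q w a = 0) :
    ∃ g ∈ orthogonalGroupOf Q, ∀ x,
      g x = x + (polar Q x w • a + (-(polar Q x a) - Q a * polar Q x w) • w) := by
  refine exists_mem_orthogonalGroupOf_of_isometry hQ
    (LinearMap.id + ((LinearMap.toSpanSingleton F V a) ∘ₗ Q.polarBilin.flip w +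
      (LinearMap.toSpanSingleton F V w) ∘ₗ (-Q.polarBilin.flip a - Q a • Q.polarBilin.flip w)))
      ?_ |>.imp fun g hg => ⟨hg.1, fun x => ?_⟩
  · intro x
    simp only [LinearMap.add_apply, LinearMap.neg_apply, LinearMap.sub_apply, LinearMap.id_apply,
      LinearMap.comp_apply, LinearMap.smul_apply, LinearMap.flip_apply, polarBilin_apply_apply,
      LinearMap.toSpanSingleton_apply, QuadraticMap.map_add Q,
      QuadraticMap.map_smul, polar_add_right, polar_smul_right, polar_smul_left, smul_eq_mul, hw,
      polar_comm Q a w, ha]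
    ring
  · rw [hg.2]
    simp

/-- The isometry scaling the two vectors of a hyperbolic pair by inverse factors. -/
theorem exists_hyperbolic_scaling [FiniteDimensional F V] {Q : QuadraticForm F V}
    (hQ : LinearMap.ker Q.polarBilin = ⊥) {w y : V} (hw : Q w = 0) (hy : Q y = 0)
    (hwy : polar Q w y = 1) {c : F} (hc : c ≠ 0) :
    ∃ g ∈ orthogonalGroupOf Q, ∀ x,
      g x = x + (((c - 1) * polar Q x y) • w + ((c⁻¹ - 1) * polar Q x w) • y) := by
  refine exists_mem_orthogonalGroupOf_of_isometry hQ
    (LinearMap.id + ((LinearMap.toSpanSingleton F V w) ∘ₗ ((c - 1) • Q.polarBilin.flip y) +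
      (LinearMap.toSpanSingleton F V y) ∘ₗ ((c⁻¹ - 1) • Q.polarBilin.flip w)))
      ?_ |>.imp fun g hg => ⟨hg.1, fun x => ?_⟩
  · intro x
    simp only [LinearMap.add_apply, LinearMap.id_apply,
      LinearMap.comp_apply, LinearMap.smul_apply, LinearMap.flip_apply, polarBilin_apply_apply,
      LinearMap.toSpanSingleton_apply, QuadraticMap.map_add Q,
      QuadraticMap.map_smul, polar_add_right, polar_smul_right, polar_smul_left, smul_eq_mul, hw,
      hy, hwy]
    field_simp
    ring
  · rw [hg.2]
    simp

/-- The one-vector step of Witt's theorem. The difference `w = u' - u` is orthogonal to `H` and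
`polar Q u w = -Q w`. If `Q w ≠ 0`, the reflection along `w` works. If `w` is singular, an Eichler
transformation works when `u ∉ H + F w`, and a hyperbolic scaling of `w` when `u ∈ H + F w`. -/
theorem exists_isometry_fixing_of_notMem [FiniteDimensional F V] {Q : QuadraticForm F V}
    (hQ : LinearMap.ker Q.polarBilin = ⊥) {H : Submodule F V} {u u' : V} (hu : u ∉ H)
    (hu' : u' ∉ H) (huu : Q u' = Q u) (hH : ∀ h ∈ H, polar Q h u' = polar Q h u) :
    ∃ g ∈ orthogonalGroupOf Q, (∀ h ∈ H, g h = h) ∧ g u = u' := by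
  obtain ⟨w, rfl⟩ : ∃ w, u' = u + w := ⟨u' - u, by simp⟩
  have hHw : ∀ h ∈ H, polar Q h w = 0 := by
    intro h hh
    simpa [polar_add_right] using hH h hh
  have huw : polar Q u w = - Q w := by
    rw [QuadraticMap.map_add Q] at huu
    linear_combination huu
  by_cases hw : Q w = 0
  · rw [hw, neg_zero] at huw
    by_cases huS : u ∈ H ⊔ F ∙ w
    · obtain ⟨h, hh, z, hz, rfl⟩ := Submodule.mem_sup.1 huS
      obtain ⟨c, rfl⟩ := Submodule.mem_span_singleton.1 hz
      have hwH : w ∉ H := fun hwH => hu (H.add_mem hh (H.smul_mem c hwH))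
      have hc : c ≠ 0 := by
        rintro rfl
        simp [hh] at hu
      have hc1 : c + 1 ≠ 0 := by
        intro hc1
        apply hu'
        rw [add_assoc, show c • w + w = (c + 1) • w by rw [add_smul, one_smul], hc1]
        simpa
      obtain ⟨y, hwy, hHy⟩ := exists_polar_eq_one_of_notMem hQ hwH
      have hww : polar Q w w = 0 := by simp [polar_self, hw]
      -- Subtracting `Q y • w` makes `y` singular. As `u = h + c w` and `u' = h + (c + 1) w`, the
      -- factor on `w` must be `(c + 1) / c`.
      obtain ⟨g, hg, hgx⟩ := exists_hyperbolic_scaling hQ (w := w) (y := y - Q y • w) hw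
        (by
          simp only [sub_eq_add_neg, QuadraticMap.map_add Q, QuadraticMap.map_neg,
            QuadraticMap.map_smul, polar_neg_right, polar_smul_right, smul_eq_mul, hw,
            polar_comm Q y w, hwy]
          ring)
        (by simp [polar_sub_right, hwy, hww]) (c := (c + 1) / c) (div_ne_zero hc1 hc)
      have hgH : ∀ h ∈ H, g h = h := by
        intro h hh
        simp [hgx, hHw h hh, polar_sub_right, hHy h hh]
      refine ⟨g, hg, hgH, ?_⟩
      have hgw : g w = ((c + 1) / c) • w := by
        simp [hgx, hww, polar_sub_right, hwy, sub_smul]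
      rw [map_add, map_smul, hgH h hh, hgw, smul_smul, mul_div_cancel₀ _ hc, add_smul, one_smul,
        add_assoc]
    · obtain ⟨a, hua, hSa⟩ := exists_polar_eq_one_of_notMem hQ huS
      have hwa : polar Q w a = 0 :=
        hSa w (Submodule.mem_sup_right (Submodule.mem_span_singleton_self w))
      obtain ⟨g, hg, hgx⟩ := exists_eichler hQ (w := w) (a := -a) hw (by simp [hwa])
      refine ⟨g, hg, fun h hh => ?_, ?_⟩
      · simp [hgx, hHw h hh, hSa h (Submodule.mem_sup_left hh)]
      · simp [hgx, huw, hua]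
  · obtain ⟨g, hg, hgx⟩ := exists_reflection hQ hw
    refine ⟨g, hg, fun h hh => ?_, ?_⟩
    · simp [hgx, hHw h hh]
    · simp [hgx, huw, hw]

/-- **Witt's extension theorem**, in every characteristic, for a form with nondegenerate polar form:
two linear maps into `V` with the same kernel that pull `Q` back to the same form differ by an
isometry. -/
theorem exists_isometry_comp_eq [FiniteDimensional F V] {Q : QuadraticForm F V}
    (hQ : LinearMap.ker Q.polarBilin = ⊥) {E : Type*} [AddCommGroup E] [Module F E]
    [Module.Finite F E] {a b : E →ₗ[F] V} (hker : LinearMap.ker a = LinearMap.ker b)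
    (hab : Q.comp a = Q.comp b) : ∃ g ∈ orthogonalGroupOf Q, ∀ x, g (a x) = b x := by
  classical
  have hab' : ∀ x, Q (a x) = Q (b x) := fun x => DFunLike.congr_fun hab x
  have hpol : ∀ x y, polar Q (a x) (a y) = polar Q (b x) (b y) := by
    intro x y
    simp only [polar, ← map_add, hab']
  have hk : ∀ x y, a x = a y ↔ b x = b y := by
    intro x y
    rw [← sub_eq_zero, ← map_sub, ← LinearMap.mem_ker, hker, LinearMap.mem_ker, map_sub,
      sub_eq_zero]
  have key : ∀ s : Finset E, ∃ g ∈ orthogonalGroupOf Q,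
      ∀ x ∈ Submodule.span F (s : Set E), g (a x) = b x := by
    intro s
    induction s using Finset.induction_on with
    | empty => exact ⟨1, one_mem _, by simp⟩
    | insert e s _ ih =>
      obtain ⟨g, hg, hgs⟩ := ih
      set S := Submodule.span F (s : Set E)
      suffices ∃ g' ∈ orthogonalGroupOf Q, (∀ x ∈ S, g' (a x) = b x) ∧ g' (a e) = b e by
        obtain ⟨g', hg', h1, h2⟩ := this
        refine ⟨g', hg', fun x hx => ?_⟩
        rw [Finset.coe_insert, Submodule.mem_span_insert] at hx
        obtain ⟨c, z, hz, rfl⟩ := hx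
        simp [h1 z hz, h2]
      -- If `a e` is already in the image of `S`, equality of the kernels forces `g (a e) = b e`.
      -- Otherwise `g` is corrected on the right by an isometry fixing `a(S)` and sending `a e` to
      -- `g⁻¹ (b e)`.
      by_cases he : a e ∈ S.map a
      · obtain ⟨x, hx, hxe⟩ := he
        exact ⟨g, hg, hgs, by rw [← hxe, hgs x hx]; exact (hk _ _).1 hxe⟩
      · have hginv : ∀ v, g (g⁻¹ v) = v := fun v => LinearEquiv.apply_symm_apply g v
        have hQg : ∀ v, Q (g v) = Q v := hg
        obtain ⟨t, ht, htH, hte⟩ := exists_isometry_fixing_of_notMem hQ (H := S.map a) (u := a e)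
          (u' := g⁻¹ (b e)) he
          (by
            rintro ⟨x, hx, hxe⟩
            apply he
            refine ⟨x, hx, (hk _ _).2 ?_⟩
            rw [← hgs x hx, hxe, hginv])
          (by rw [← hQg, hginv, hab'])
          (by
            rintro _ ⟨x, hx, rfl⟩
            have : ∀ v v', polar Q v v' = polar Q (g v) (g v') := by
              intro v v'
              simp only [polar, ← map_add, hQg]
            rw [this, hginv, hgs x hx, hpol])
        refine ⟨g * t, mul_mem hg ht, fun x hx => ?_, ?_⟩
        · rw [LinearEquiv.mul_apply, htH _ ⟨x, hx, rfl⟩, hgs x hx]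
        · rw [LinearEquiv.mul_apply, hte, hginv]
  obtain ⟨s, hs⟩ := (Module.Finite.fg_top : (⊤ : Submodule F E).FG)
  obtain ⟨g, hg, h⟩ := key s
  exact ⟨g, hg, fun x => h x (by rw [hs]; trivial)⟩

end Witt

/-! ### Counting subspaces and quadratic forms over a finite field -/

section Counting

open Module QuadraticMap

variable {F : Type*} [Field F]

/-! ### Subspaces of `E × F`, by codimension -/

section Submodules

variable {E : Type*} [AddCommGroup E] [Module F E]

/-- The subspaces of `E × F` in terms of those of `E`: a subspace `W` of `E` gives `W × 0`, and
every class in `E ⧸ W` gives a subspace projecting onto `F`. -/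
def Submodule.ofOptionQuotient (W : Submodule F E) : Option (E ⧸ W) → Submodule F (E × F)
  | none => LinearMap.ker (W.mkQ.prodMap (LinearMap.id : F →ₗ[F] F))
  | some x => LinearMap.ker
      (W.mkQ ∘ₗ LinearMap.fst F E F - LinearMap.toSpanSingleton F (E ⧸ W) x ∘ₗ LinearMap.snd F E F)

theorem Submodule.mem_ofOptionQuotient_none {W : Submodule F E} {p : E × F} :
    p ∈ W.ofOptionQuotient none ↔ p.1 ∈ W ∧ p.2 = 0 := by
  simp [ofOptionQuotient]

theorem Submodule.mem_ofOptionQuotient_some {W : Submodule F E} {x : E ⧸ W} {p : E × F} :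
    p ∈ W.ofOptionQuotient (some x) ↔ W.mkQ p.1 = p.2 • x := by
  simp [ofOptionQuotient, sub_eq_zero]

theorem Submodule.mk_zero_mem_ofOptionQuotient {W : Submodule F E} {o : Option (E ⧸ W)} {e : E} :
    (e, (0 : F)) ∈ W.ofOptionQuotient o ↔ e ∈ W := by
  cases o <;> simp [mem_ofOptionQuotient_none, mem_ofOptionQuotient_some]

theorem Submodule.bijective_ofOptionQuotient : Function.Bijective
    fun p : Σ W : Submodule F E, Option (E ⧸ W) => p.1.ofOptionQuotient p.2 := by
  constructor
  · rintro ⟨W, o⟩ ⟨W', o'⟩ h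
    dsimp only at h
    obtain rfl : W = W' := by
      ext e
      rw [← mk_zero_mem_ofOptionQuotient (o := o), h, mk_zero_mem_ofOptionQuotient]
    have h1 : ∀ e, (e, (1 : F)) ∈ W.ofOptionQuotient o ↔ (e, (1 : F)) ∈ W.ofOptionQuotient o' := by
      simp [h]
    congr 1
    cases o with
    | none =>
      cases o' with
      | none => rfl
      | some x' =>
        obtain ⟨e, rfl⟩ := W.mkQ_surjective x'
        simpa [mem_ofOptionQuotient_none, mem_ofOptionQuotient_some] using h1 e
    | some x =>
      obtain ⟨e, rfl⟩ := W.mkQ_surjective x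
      cases o' with
      | none => simpa [mem_ofOptionQuotient_none, mem_ofOptionQuotient_some] using h1 e
      | some x' =>
        have := (h1 e).1 (by simp [mem_ofOptionQuotient_some])
        simpa [mem_ofOptionQuotient_some] using this
  · intro W'
    have hcomap : ∀ e, e ∈ W'.comap (LinearMap.inl F E F) ↔ (e, (0 : F)) ∈ W' := fun e => Iff.rfl
    by_cases h : ∃ e, (e, (1 : F)) ∈ W'
    · obtain ⟨e, he⟩ := h
      refine ⟨⟨W'.comap (LinearMap.inl F E F), some (Submodule.mkQ _ e)⟩, ?_⟩
      ext ⟨x, t⟩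
      simp only [mem_ofOptionQuotient_some]
      rw [← map_smul, ← sub_eq_zero, ← map_sub, ← LinearMap.mem_ker, Submodule.ker_mkQ, hcomap]
      rw [show (x - t • e, (0 : F)) = (x, t) - t • (e, (1 : F)) by simp]
      exact Submodule.sub_mem_iff_left _ (W'.smul_mem t he)
    · refine ⟨⟨W'.comap (LinearMap.inl F E F), none⟩, ?_⟩
      ext ⟨x, t⟩
      simp only [mem_ofOptionQuotient_none, hcomap]
      constructor
      · rintro ⟨hx, rfl⟩
        exact hx
      · intro hx
        have ht : t = 0 := by
          by_contra ht
          refine h ⟨t⁻¹ • x, ?_⟩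
          have := W'.smul_mem t⁻¹ hx
          simpa [ht] using this
        subst ht
        exact ⟨hx, rfl⟩

theorem Submodule.finrank_quotient_ofOptionQuotient_none [FiniteDimensional F E] (W : Submodule F E) :
    finrank F ((E × F) ⧸ W.ofOptionQuotient none) = finrank F (E ⧸ W) + 1 := by
  have hs : Function.Surjective (W.mkQ.prodMap (LinearMap.id : F →ₗ[F] F)) := by
    rw [LinearMap.coe_prodMap]
    exact W.mkQ_surjective.prodMap Function.surjective_id
  rw [ofOptionQuotient, (LinearMap.quotKerEquivOfSurjective _ hs).finrank_eq, finrank_prod,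
    finrank_self]

theorem Submodule.finrank_quotient_ofOptionQuotient_some (W : Submodule F E) (x : E ⧸ W) :
    finrank F ((E × F) ⧸ W.ofOptionQuotient (some x)) = finrank F (E ⧸ W) := by
  rw [ofOptionQuotient]
  refine (LinearMap.quotKerEquivOfSurjective _ fun y => ?_).finrank_eq
  obtain ⟨e, rfl⟩ := W.mkQ_surjective y
  exact ⟨(e, 0), by simp⟩

/-- A subspace of codimension `r` in `E` yields one subspace of codimension `r + 1` in `E × F` and
`|F| ^ r` of codimension `r`. -/
theorem Submodule.sum_finrank_quotient_prod [FiniteDimensional F E] [Fintype (Submodule F E)]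
    [Fintype (Submodule F (E × F))] [Finite F] (g : ℕ → ℕ) :
    ∑ W : Submodule F (E × F), g (finrank F ((E × F) ⧸ W)) =
      ∑ W : Submodule F E, (g (finrank F (E ⧸ W) + 1) +
        Nat.card F ^ finrank F (E ⧸ W) * g (finrank F (E ⧸ W))) := by
  have : Finite E := Module.finite_of_finite F
  let _ : ∀ W : Submodule F E, Fintype (E ⧸ W) := fun W =>
    have := Finite.of_surjective _ W.mkQ_surjective
    Fintype.ofFinite _
  rw [← Function.Bijective.sum_comp bijective_ofOptionQuotient, Fintype.sum_sigma]
  refine Finset.sum_congr rfl fun W _ => ?_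
  rw [Fintype.sum_option, finrank_quotient_ofOptionQuotient_none]
  simp only [finrank_quotient_ofOptionQuotient_some, Finset.sum_const, smul_eq_mul,
    Finset.card_univ]
  rw [← Nat.card_eq_fintype_card, ← Module.natCard_eq_pow_finrank]

theorem Submodule.sum_finrank_quotient_congr {E' : Type*} [AddCommGroup E'] [Module F E']
    [Fintype (Submodule F E)] [Fintype (Submodule F E')] (e : E ≃ₗ[F] E') (g : ℕ → ℕ) :
    ∑ W : Submodule F E, g (finrank F (E ⧸ W)) =
      ∑ W : Submodule F E', g (finrank F (E' ⧸ W)) := by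
  refine Fintype.sum_equiv (Submodule.orderIsoMapComap e).toEquiv _ _ fun W => ?_
  exact congrArg g (Submodule.Quotient.equiv W _ e rfl).finrank_eq

end Submodules

/-! ### The number of quadratic forms on a finite space -/

section Forms

variable {E : Type*} [AddCommGroup E] [Module F E]

/-- A quadratic form on `E × F` is a quadratic form on `E`, a linear form on `E` and a scalar. -/
def QuadraticMap.prodScalarEquiv :
    QuadraticForm F (E × F) ≃ QuadraticForm F E × Dual F E × F where
  toFun Q := (Q.comp (LinearMap.inl F E F), Q.polarBilin (0, 1) ∘ₗ LinearMap.inl F E F, Q (0, 1))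
  invFun p := p.1.comp (LinearMap.fst F E F) +
    linMulLin (LinearMap.snd F E F) (p.2.1 ∘ₗ LinearMap.fst F E F) +
    p.2.2 • linMulLin (LinearMap.snd F E F) (LinearMap.snd F E F)
  left_inv Q := by
    ext ⟨x, t⟩
    have h : ((x, t) : E × F) = (x, 0) + t • (0, 1) := by simp
    rw [h, QuadraticMap.map_add Q, QuadraticMap.map_smul, polar_smul_right, polar_comm Q (x, 0),
      ← h]
    simp
    ring
  right_inv := by
    rintro ⟨Q, φ, c⟩
    refine Prod.ext ?_ (Prod.ext ?_ ?_)
    · ext x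
      simp
    · ext x
      simp [polar]
    · simp

theorem QuadraticMap.natCard_congr {E' : Type*} [AddCommGroup E'] [Module F E'] (e : E ≃ₗ[F] E') :
    Nat.card (QuadraticForm F E) = Nat.card (QuadraticForm F E') :=
  Nat.card_congr
    { toFun := fun Q => Q.comp (e.symm : E' →ₗ[F] E)
      invFun := fun Q => Q.comp (e : E →ₗ[F] E')
      left_inv := fun Q => by ext x; simp
      right_inv := fun Q => by ext x; simp }

theorem QuadraticMap.natCard_pi (r : ℕ) :
    Nat.card (QuadraticForm F (Fin r → F)) = ∏ i ∈ Finset.range r, Nat.card F ^ (i + 1) := by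
  induction r with
  | zero =>
    have : Subsingleton (QuadraticForm F (Fin 0 → F)) :=
      ⟨fun a b => by
        ext x
        rw [Subsingleton.elim x 0, QuadraticMap.map_zero, QuadraticMap.map_zero]⟩
    have : Unique (QuadraticForm F (Fin 0 → F)) := Unique.mk' _
    simp
  | succ r ih =>
    rw [← natCard_congr ((LinearEquiv.prodComm F (Fin r → F) F).trans
      (Fin.consLinearEquiv F fun _ : Fin (r + 1) => F)), Nat.card_congr prodScalarEquiv,
      Nat.card_prod, Nat.card_prod, ih, Finset.prod_range_succ, pow_succ]
    rw [Nat.card_congr (Module.piEquiv (Fin r) F F).symm.toEquiv, Nat.card_fun]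
    simp

theorem QuadraticMap.natCard_eq [FiniteDimensional F E] :
    Nat.card (QuadraticForm F E) = ∏ i ∈ Finset.range (finrank F E), Nat.card F ^ (i + 1) := by
  rw [natCard_congr (Module.finBasis F E).equivFun, natCard_pi]

instance QuadraticMap.finite [Finite F] [Finite E] : Finite (QuadraticForm F E) :=
  DFunLike.finite _

end Forms

/-- The weight `|F| ^ (m r)` makes the induction on `j` close. With `q = |F|` and `g_m r = q ^ (r (r
+ 1) / 2 + m r)`, one has `g_m (r + 1) + q ^ r * g_m r = (q ^ (m + 1) + 1) * g_(m + 1) r`, so each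
step splits off one factor and raises `m` by one. Only `m = 0` is used later. -/
theorem Submodule.sum_card_quadraticForm [Finite F] (j m : ℕ) :
    ∀ [Fintype (Submodule F (Fin j → F))], ∑ W : Submodule F (Fin j → F),
      (∏ i ∈ Finset.range (finrank F ((Fin j → F) ⧸ W)), Nat.card F ^ (i + 1)) *
        Nat.card F ^ (m * finrank F ((Fin j → F) ⧸ W)) =
      ∏ i ∈ Finset.range j, (Nat.card F ^ (m + (i + 1)) + 1) := by
  induction j generalizing m with
  | zero =>
    intro _
    have h : ∀ W : Submodule F (Fin 0 → F), finrank F ((Fin 0 → F) ⧸ W) = 0 := fun W =>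
      finrank_zero_of_subsingleton
    simp only [h, Finset.range_zero, Finset.prod_empty, mul_zero, pow_zero, Finset.sum_const,
      smul_eq_mul, mul_one, Finset.card_univ]
    exact Fintype.card_eq_one_iff.2 ⟨⊥, fun W => Subsingleton.elim _ _⟩
  | succ j ih =>
    intro _
    let _ : Fintype (Submodule F (Fin j → F)) := Fintype.ofFinite _
    let _ : Fintype (Submodule F ((Fin j → F) × F)) := Fintype.ofFinite _
    have e : ((Fin j → F) × F) ≃ₗ[F] (Fin (j + 1) → F) :=
      (LinearEquiv.prodComm F (Fin j → F) F).trans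
        (Fin.consLinearEquiv F fun _ : Fin (j + 1) => F)
    let g : ℕ → ℕ := fun r =>
      (∏ i ∈ Finset.range r, Nat.card F ^ (i + 1)) * Nat.card F ^ (m * r)
    have h := (sum_finrank_quotient_congr e g).symm.trans (sum_finrank_quotient_prod g)
    have hstep : ∏ i ∈ Finset.range (j + 1), (Nat.card F ^ (m + (i + 1)) + 1) =
        (Nat.card F ^ (m + 1) + 1) *
          ∏ i ∈ Finset.range j, (Nat.card F ^ (m + 1 + (i + 1)) + 1) := by
      rw [Finset.prod_range_succ', mul_comm]
      simp only [zero_add, add_left_comm, add_comm]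
    rw [hstep, ← ih, Finset.mul_sum]
    refine h.trans (Finset.sum_congr rfl fun W _ => ?_)
    simp only [g]
    rw [Finset.prod_range_succ]
    ring

/-- The number of quadratic forms on quotients of `F ^ j`. -/
theorem natCard_submodule_le_radical [Finite F] (j : ℕ) :
    Nat.card {p : Submodule F (Fin j → F) × QuadraticForm F (Fin j → F) // p.1 ≤ p.2.radical} =
      ∏ i ∈ Finset.Icc 1 j, (Nat.card F ^ i + 1) := by
  let _ : Fintype (Submodule F (Fin j → F)) := Fintype.ofFinite _
  -- A form with `W` in its radical is the same as a form on the quotient by `W`.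
  let e : {p : Submodule F (Fin j → F) × QuadraticForm F (Fin j → F) // p.1 ≤ p.2.radical} ≃
      Σ W : Submodule F (Fin j → F), QuadraticForm F ((Fin j → F) ⧸ W) :=
    { toFun := fun p => ⟨p.1.1, p.1.2.lift p.1.1 p.2⟩
      invFun := fun p => ⟨(p.1, p.2.comp p.1.mkQ), le_radical_iff.2 ⟨p.2, rfl⟩⟩
      left_inv := fun p => rfl
      right_inv := by
        rintro ⟨W, Q⟩
        refine congrArg (Sigma.mk W) ?_
        ext x
        obtain ⟨x, rfl⟩ := W.mkQ_surjective x
        rfl }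
  have h := Submodule.sum_card_quadraticForm (F := F) j 0
  simp only [zero_mul, pow_zero, mul_one, zero_add] at h
  have hfin : ∀ W : Submodule F (Fin j → F), Finite (QuadraticForm F ((Fin j → F) ⧸ W)) :=
    fun W =>
      have := Finite.of_surjective _ W.mkQ_surjective
      inferInstance
  rw [Nat.card_congr e, Nat.card_sigma, ← Finset.Ico_add_one_right_eq_Icc,
    Finset.prod_Ico_eq_prod_range, Nat.add_sub_cancel]
  simp only [add_comm 1, ← h]
  exact Finset.sum_congr rfl fun W _ => QuadraticMap.natCard_eq

end Counting

/-! ### Orbits of the orthogonal group on tuples of vectors -/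

section Orbits

open Module QuadraticMap

variable {F V : Type*} [Field F] [AddCommGroup V] [Module F V]

theorem exists_linearCombination_eq {j : ℕ} (f : (Fin j → F) →ₗ[F] V) :
    ∃ v : Fin j → V, Fintype.linearCombination F v = f := by
  classical
  refine ⟨fun i => f (Pi.single i 1), ?_⟩
  refine LinearMap.pi_ext' fun i => LinearMap.ext_ring ?_
  simp [Fintype.linearCombination_apply_single]

variable [FiniteDimensional F V]

/-- If `V` has a totally singular subspace of dimension at least `dim U`, then every quadratic
form on `U` is induced by an embedding of `U` into `V`. -/
theorem exists_injective_comp_eq {Q : QuadraticForm F V} (hQ : LinearMap.ker Q.polarBilin = ⊥)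
    {W : Submodule F V} (hW : IsTotallySingular Q W) {U : Type*} [AddCommGroup U] [Module F U]
    [FiniteDimensional F U] (hUW : finrank F U ≤ finrank F W) (q : QuadraticForm F U) :
    ∃ f : U →ₗ[F] V, Function.Injective f ∧ Q.comp f = q := by
  obtain ⟨i₀, hi₀⟩ : ∃ f : Dual F U →ₗ[F] W, Function.Injective f :=
    finrank_le_iff_exists_linearMap.1 (by rwa [Subspace.dual_finrank_eq])
  obtain ⟨i, hi, hiQ⟩ : ∃ i : Dual F U →ₗ[F] V, Function.Injective i ∧ ∀ φ, Q (i φ) = 0 :=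
    ⟨W.subtype ∘ₗ i₀, W.injective_subtype.comp hi₀, fun φ => hW _ (i₀ φ).2⟩
  have hii : ∀ φ ψ, polar Q (i φ) (i ψ) = 0 := by
    intro φ ψ
    simp only [polar, ← map_add, hiQ, sub_zero]
  -- `k` maps `U` into `V` in duality with the singular copy `i` of its dual. The pairing with `i φ`
  -- will give injectivity.
  obtain ⟨k, hk⟩ : ∃ k : U →ₗ[F] V, ∀ φ x, polar Q (i φ) (k x) = φ x := by
    obtain ⟨l, hl⟩ := LinearMap.exists_leftInverse_of_injective i (LinearMap.ker_eq_bot.2 hi)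
    let B : V ≃ₗ[F] Dual F V := LinearEquiv.ofInjectiveOfFinrankEq Q.polarBilin
      (LinearMap.ker_eq_bot.1 hQ) Subspace.dual_finrank_eq.symm
    refine ⟨B.symm.toLinearMap ∘ₗ l.dualMap ∘ₗ Dual.eval F U, fun φ x => ?_⟩
    have h : ∀ ξ y, polar Q y (B.symm ξ) = ξ y := by
      intro ξ y
      rw [polar_comm, ← polarBilin_apply_apply]
      exact LinearMap.congr_fun (B.apply_symm_apply ξ) y
    have hlφ : l (i φ) = φ := LinearMap.congr_fun hl φ
    simp [h, hlφ]
  -- The error `q - Q ∘ k` is the diagonal of some bilinear form `b`, not necessarily symmetric, in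
  -- every characteristic. Adding `i ∘ b` to `k` changes `Q` by exactly `b x x`.
  obtain ⟨b, hb⟩ := LinearMap.BilinMap.toQuadraticMap_surjective (q - Q.comp k)
  have hb' : ∀ x, b x x = q x - Q (k x) := fun x => DFunLike.congr_fun hb x
  refine ⟨k + i ∘ₗ b, ?_, ?_⟩
  · rw [← LinearMap.ker_eq_bot, LinearMap.ker_eq_bot']
    intro x hx
    rw [← Module.forall_dual_apply_eq_zero_iff F]
    intro φ
    rw [← hk φ x, ← add_zero (polar Q _ _), ← hii φ (b x), ← polar_add_right]
    have : k x + i (b x) = 0 := hx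
    rw [this, polar_zero_right, hii]
  · ext x
    have : Q (k x + i (b x)) = q x := by
      rw [QuadraticMap.map_add Q, hiQ, polar_comm, hk, hb']
      ring
    exact this

theorem bddAbove_finrank_isTotallySingular (Q : QuadraticForm F V) :
    BddAbove {d | ∃ W : Submodule F V, IsTotallySingular Q W ∧ finrank F W = d} :=
  ⟨finrank F V, by rintro _ ⟨W, _, rfl⟩; exact W.finrank_le⟩

theorem exists_isTotallySingular_finrank_eq_wittIndex (Q : QuadraticForm F V) :
    ∃ W : Submodule F V, IsTotallySingular Q W ∧ finrank F W = wittIndex Q :=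
  Nat.sSup_mem (s := {d | ∃ W : Submodule F V, IsTotallySingular Q W ∧ finrank F W = d})
    ⟨0, ⊥, by rintro _ rfl; exact QuadraticMap.map_zero Q, finrank_bot F V⟩
    (bddAbove_finrank_isTotallySingular Q)

theorem IsTotallySingular.finrank_le_wittIndex {Q : QuadraticForm F V} {W : Submodule F V}
    (hW : IsTotallySingular Q W) : finrank F W ≤ wittIndex Q :=
  le_csSup (bddAbove_finrank_isTotallySingular Q) ⟨W, hW, rfl⟩

/-- The linear relations between the members of a tuple, and the form that it induces. -/
noncomputable def tupleInvariant (Q : QuadraticForm F V) {j : ℕ} (v : Fin j → V) :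
    {p : Submodule F (Fin j → F) × QuadraticForm F (Fin j → F) // p.1 ≤ p.2.radical} :=
  ⟨(LinearMap.ker (Fintype.linearCombination F v), Q.comp (Fintype.linearCombination F v)), by
    intro x hx
    have hx' : Fintype.linearCombination F v x = 0 := hx
    rw [mem_radical_iff']
    simp only [QuadraticMap.comp_apply, map_add, hx', QuadraticMap.map_zero, zero_add, true_and,
      implies_true]⟩

/-- The invariant separates exactly the orbits of the orthogonal group on tuples. -/
theorem tupleInvariant_eq_iff {Q : QuadraticForm F V} (hQ : LinearMap.ker Q.polarBilin = ⊥)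
    {j : ℕ} {v v' : Fin j → V} :
    tupleInvariant Q v = tupleInvariant Q v' ↔
      ∃ g : orthogonalGroupOf Q, ∀ i, (g : V ≃ₗ[F] V) (v i) = v' i := by
  classical
  constructor
  · intro h
    rw [tupleInvariant, tupleInvariant, Subtype.mk.injEq, Prod.mk.injEq] at h
    obtain ⟨g, hg, hgx⟩ := exists_isometry_comp_eq hQ h.1 h.2
    refine ⟨⟨g, hg⟩, fun i => ?_⟩
    have := hgx (Pi.single i 1)
    simpa [Fintype.linearCombination_apply_single] using this
  · rintro ⟨⟨g, hg⟩, hgv⟩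
    have h : Fintype.linearCombination F v' =
        g.toLinearMap ∘ₗ Fintype.linearCombination F v := by
      ext i
      simp [Fintype.linearCombination_apply_single, ← hgv]
    have hg' : ∀ x, Q (g x) = Q x := hg
    refine Subtype.ext (Prod.ext ?_ ?_)
    · simp [tupleInvariant, h, LinearMap.ker_comp]
    · ext x
      simp [tupleInvariant, h, hg']

theorem surjective_tupleInvariant {Q : QuadraticForm F V}
    (hQ : LinearMap.ker Q.polarBilin = ⊥) {j : ℕ} (hj : j ≤ wittIndex Q) :
    Function.Surjective (tupleInvariant Q : (Fin j → V) → _) := by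
  rintro ⟨⟨W, q⟩, hWq⟩
  obtain ⟨S, hS, hSQ⟩ := exists_isTotallySingular_finrank_eq_wittIndex Q
  obtain ⟨f, hf, hfq⟩ := exists_injective_comp_eq hQ hS
    (by
      rw [hSQ]
      refine (Submodule.finrank_quotient_le W).trans ?_
      rwa [finrank_fin_fun]) (q.lift W hWq)
  obtain ⟨v, hv⟩ := exists_linearCombination_eq (f ∘ₗ W.mkQ)
  refine ⟨v, Subtype.ext (Prod.ext ?_ ?_)⟩
  · simp [tupleInvariant, hv, LinearMap.ker_comp, LinearMap.ker_eq_bot.2 hf]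
  · simp only [tupleInvariant, hv]
    ext x
    exact DFunLike.congr_fun hfq (W.mkQ x)

/-- A tuple with invariant `(⊥, 0)` would be a basis of a totally singular subspace of dimension
`j`. -/
theorem not_surjective_tupleInvariant {Q : QuadraticForm F V} {j : ℕ} (hj : wittIndex Q < j) :
    ¬ Function.Surjective (tupleInvariant Q : (Fin j → V) → _) := by
  intro h
  obtain ⟨v, hv⟩ := h ⟨(⊥, 0), bot_le⟩
  rw [tupleInvariant, Subtype.mk.injEq, Prod.mk.injEq] at hv
  have hs : IsTotallySingular Q (LinearMap.range (Fintype.linearCombination F v)) := by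
    rintro _ ⟨x, rfl⟩
    exact DFunLike.congr_fun hv.2 x
  have := hs.finrank_le_wittIndex
  rw [LinearMap.finrank_range_of_inj (LinearMap.ker_eq_bot.1 hv.1), finrank_fin_fun] at this
  omega

/-- The moment is the number of orbits on tuples. -/
theorem fixedVectorMoment_eq_natCard_range [Finite F] {Q : QuadraticForm F V}
    (hQ : LinearMap.ker Q.polarBilin = ⊥) (j : ℕ) :
    fixedVectorMoment Q j =
      Nat.card (Set.range (tupleInvariant Q : (Fin j → V) → _)) := by
  classical
  have : Finite V := Module.finite_of_finite F
  let _ := Fintype.ofFinite (orthogonalGroupOf Q)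
  let _ : ∀ g : orthogonalGroupOf Q, Fintype (MulAction.fixedBy (Fin j → V) g) :=
    fun g => Fintype.ofFinite _
  let _ : Fintype (Quotient (MulAction.orbitRel (orthogonalGroupOf Q) (Fin j → V))) :=
    Fintype.ofFinite _
  -- Burnside's lemma on `V ^ j`: a tuple is fixed exactly when all its entries are, which gives the
  -- `j`-th power.
  have hB := MulAction.sum_card_fixedBy_eq_card_orbits_mul_card_group
    (orthogonalGroupOf Q) (Fin j → V)
  have hfix : ∀ g : orthogonalGroupOf Q,
      Fintype.card (MulAction.fixedBy (Fin j → V) g) = numFixedVectors g ^ j := by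
    intro g
    let e : MulAction.fixedBy (Fin j → V) g ≃ (Fin j → {v : V // (g : V ≃ₗ[F] V) v = v}) :=
      { toFun := fun v i => ⟨v.1 i, congrFun v.2 i⟩
        invFun := fun v => ⟨fun i => (v i).1, funext fun i => (v i).2⟩
        left_inv := fun v => rfl
        right_inv := fun v => rfl }
    rw [← Nat.card_eq_fintype_card, Nat.card_congr e, Nat.card_fun, numFixedVectors, Nat.card_fin]
  have horb : Nat.card (Quotient (MulAction.orbitRel (orthogonalGroupOf Q) (Fin j → V))) =
      Nat.card (Set.range (tupleInvariant Q : (Fin j → V) → _)) := by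
    have hs : MulAction.orbitRel (orthogonalGroupOf Q) (Fin j → V) =
        Setoid.ker (tupleInvariant Q : (Fin j → V) → _) := by
      ext v v'
      rw [MulAction.orbitRel_apply, Setoid.ker_def, eq_comm, tupleInvariant_eq_iff hQ]
      exact exists_congr fun g => funext_iff
    rw [hs]
    exact Nat.card_congr (Setoid.quotientKerEquivRange _)
  rw [← horb, Nat.card_eq_fintype_card]
  have hG : (Fintype.card (orthogonalGroupOf Q) : ℝ) ≠ 0 := by
    exact_mod_cast Fintype.card_ne_zero
  have hE : fixedVectorMoment Q j = (∑ g : orthogonalGroupOf Q, (numFixedVectors g : ℝ) ^ j) /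
      Fintype.card (orthogonalGroupOf Q) := Fintype.expect_eq_sum_div_card _
  rw [hE, div_eq_iff hG]
  simp only [hfix] at hB
  exact_mod_cast hB

variable [Finite F] {Q : QuadraticForm F V}

theorem fixedVectorMoment_eq_prod (hQ : LinearMap.ker Q.polarBilin = ⊥) {j : ℕ}
    (hj : j ≤ wittIndex Q) :
    fixedVectorMoment Q j = ∏ i ∈ Finset.Icc 1 j, ((Nat.card F : ℝ) ^ i + 1) := by
  rw [fixedVectorMoment_eq_natCard_range hQ, (surjective_tupleInvariant hQ hj).range_eq,
    Nat.card_congr (Equiv.Set.univ _), natCard_submodule_le_radical]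
  push_cast
  rfl

theorem fixedVectorMoment_lt_prod (hQ : LinearMap.ker Q.polarBilin = ⊥) {j : ℕ}
    (hj : wittIndex Q < j) :
    fixedVectorMoment Q j < ∏ i ∈ Finset.Icc 1 j, ((Nat.card F : ℝ) ^ i + 1) := by
  have h := natCard_submodule_le_radical (F := F) j
  have hlt : (Set.range (tupleInvariant Q : (Fin j → V) → _)).ncard <
      Set.univ.ncard (α := {p : Submodule F (Fin j → F) × QuadraticForm F (Fin j → F) //
        p.1 ≤ p.2.radical}) :=
    Set.ncard_lt_ncard (Set.ssubset_univ_iff.2 fun hr =>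
      not_surjective_tupleInvariant hj (Set.range_eq_univ.1 hr)) Set.finite_univ
  rw [Set.ncard_univ, h] at hlt
  rw [fixedVectorMoment_eq_natCard_range hQ, Nat.card_coe_set_eq]
  exact_mod_cast hlt

end Orbits

theorem mainTheorem6 {F V : Type*} [Field F] [Finite F] [AddCommGroup V] [Module F V]
    [Module.Finite F V] (Q : QuadraticForm F V) (q : ℕ) (hq : Nat.card F = q) (n j : ℕ) :
    -- the group `O⁻(2n,q)`: the moment has its stable value for `n ≥ j + 1`, and for no smaller `n`
    (IsMinusType Q n →
      (j + 1 ≤ n → fixedVectorMoment Q j = ∏ i ∈ Finset.Icc 1 j, ((q : ℝ) ^ i + 1)) ∧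
      (1 ≤ j → n ≤ j → fixedVectorMoment Q j ≠ ∏ i ∈ Finset.Icc 1 j, ((q : ℝ) ^ i + 1))) ∧
    -- the group `O⁺(2n,q)`: the moment has its stable value for `n ≥ j`, and for no smaller `n`
    (IsPlusType Q n →
      (j ≤ n → fixedVectorMoment Q j = ∏ i ∈ Finset.Icc 1 j, ((q : ℝ) ^ i + 1)) ∧
      (n < j → fixedVectorMoment Q j ≠ ∏ i ∈ Finset.Icc 1 j, ((q : ℝ) ^ i + 1))) := by
  subst hq
  refine ⟨fun h => ?_, fun h => ?_⟩
  · have hQ := h.nondegenerate.ker_polarBilin_eq_bot (by rw [h.finrank_eq]; exact even_two_mul n)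
    have hw := h.wittIndex_eq
    exact ⟨fun hj => fixedVectorMoment_eq_prod hQ (by omega),
      fun _ hj => (fixedVectorMoment_lt_prod hQ (by omega)).ne⟩
  · have hQ := h.nondegenerate.ker_polarBilin_eq_bot (by rw [h.finrank_eq]; exact even_two_mul n)
    have hw := h.wittIndex_eq
    exact ⟨fun hj => fixedVectorMoment_eq_prod hQ (by omega),
      fun hj => (fixedVectorMoment_lt_prod hQ (by omega)).ne⟩
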